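/- \textbf{Setting.} For $n$ qubits and a binary vector $u\in\mathbb Z_2^n$ put $O(u)=O^{u_1}\otimes\cdots\otimes O^{u_n}$. A \emph{pure CSS state} is a pure $n$-qubit state that is the unique state stabilized by a group generated by $n$ Pauli observables, each of the form $\pm X(a)$ or $\pm Z(b)$; the set $\mathcal D_{css}$ of \emph{CSS states} is the convex hull of the (density matrices of) pure CSS states. Its interior is taken relative to its affine span, i.e. within the real symmetric matrices of trace one. A \emph{rebit state} is a density matrix that is real in the computational basis. A \emph{completely CSS-preserving protocol} is a channel (completely positive trace-preserving linear map) $\mathcal E$ from $n$ to $m$ qubits such that $(\mathcal I_A\otimes\mathcal E)(\sigma)$ is a CSS state for every ancillary system of qubits $A$ and every CSS state $\sigma$ on $A$ and the $n$ input qubits. For $u=(u_x,u_z)\in\mathbb Z_2^n\times\mathbb Z_2^n$ let $D_u=Z(u_z)X(u_x)$, $[u,v]=u_z\cdot v_x-v_z\cdot u_x$, $A_u=2^{-n}\sum_v(-1)^{[u,v]}D_v$ and $W_\rho(u)=2^{-n}\,\mathrm{tr}[A_u^\dagger\rho]$, which is real for every rebit state $\rho$. Let $$\mathcal A=\Big\{\tfrac{2a}{2b-1}: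 a,b\in\mathbb N,\ a\ge b\ge 1\Big\}\cup\{\infty\}.$$ For a real vector $w$ and a nonnegative vector $r$ let $$D_\alpha(w\|r)=\frac1{\alpha-1}\log_2\sum_i w_i^\alpha r_i^{1-\alpha}\quad(\alpha\in\mathcal A,\ \alpha<\infty),\qquad D_\infty(w\|r)=\log_2\max_i\frac{|w_i|}{r_i},$$ where $w_i^\alpha=|w_i|^\alpha$ (the real power $w_i^{2a/(2b-1)}$), and an index with $r_i=0$ contributes $0$ if $w_i=0$ and $+\infty$ if $w_i\ne0$. \textbf{Theorem.} (i) Let $\rho$ be a rebit state and let $\tau$ be a CSS state in the interior of $\mathcal D_{css}$, both on the same number of qubits, and let $n\in\mathbb N$. If $\mathcal E$ is a completely CSS-preserving protocol with $\mathcal E(\rho^{\otimes n})=\rho'$ and if $\tau'=\mathcal E(\tau^{\otimes n})$ is also in the interior of $\mathcal D_{css}$ (of the output qubits), then $\rho'$ is a rebit state and $$n\,D_\alpha(W_\rho\|W_\tau)\ \ge\ D_\alpha(W_{\rho'}\|W_{\tau'})\qquad\text{for all }\alpha\in\mathcal A .$$ (ii) In particular, the quantities $\Lambda_\alpha(\rho)=\inf_{\tau\in\mathcal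 D_{css}}D_\alpha(W_\rho\|W_\tau)$ are monotones: for every rebit state $\rho$ and every completely CSS-preserving protocol $\mathcal E$ acting on it, $\mathcal E(\rho)$ is a rebit state and $\Lambda_\alpha(\rho)\ge\Lambda_\alpha(\mathcal E(\rho))$ for all $\alpha\in\mathcal A$. -/

import Mathlib

/-!
# Qubit registers, CSS states, a Wigner representation for qubits, and Rényi divergences

A register of qubits is labelled by a finite type `ι` (so it has `card ι` qubits).  Its
computational basis is `ι → Fin 2`, its phase space is `(ι → ZMod 2) × (ι → ZMod 2)`.
-/

noncomputable section

namespace CSS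

open scoped ComplexOrder

/-- Operators on the qubit register `ι`, as matrices in the computational basis. -/
abbrev Op (ι : Type) : Type := Matrix (ι → Fin 2) (ι → Fin 2) ℂ

/-- Density matrices. -/
def IsState {ι : Type} [Fintype ι] [DecidableEq ι] (ρ : Op ι) : Prop :=
  ρ.PosSemidef ∧ ρ.trace = 1

/-- Rebit states: density matrices that are real in the computational basis. -/
def IsRebitState {ι : Type} [Fintype ι] [DecidableEq ι] (ρ : Op ι) : Prop :=
  IsState ρ ∧ ∀ x y, (ρ x y).im = 0

/-- The tensor power `ρ^{⊗n}`, on the register `Fin n × ι` consisting of `n` copies of `ι`. -/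
def tensorPow {ι : Type} (n : ℕ) (ρ : Op ι) : Op (Fin n × ι) :=
  Matrix.of fun x y => ∏ k : Fin n, ρ (fun i => x (k, i)) (fun i => y (k, i))

/-! ### Pauli operators and CSS states -/

/-- The Pauli matrix `X`. -/
def pauliX : Matrix (Fin 2) (Fin 2) ℂ := !![0, 1; 1, 0]

/-- The Pauli matrix `Z`. -/
def pauliZ : Matrix (Fin 2) (Fin 2) ℂ := !![1, 0; 0, -1]

/-- `O(u) = O^{u_1} ⊗ ⋯ ⊗ O^{u_n}` for a single-qubit operator `O` and a binary vector `u`. -/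
def opString {ι : Type} [Fintype ι] (O : Matrix (Fin 2) (Fin 2) ℂ) (u : ι → ZMod 2) : Op ι :=
  Matrix.of fun x y => ∏ i, (O ^ (u i).val) (x i) (y i)

/-- CSS observables: Pauli observables `±X(a)` of `X`-type or `±Z(b)` of `Z`-type. -/
def IsCSSObservable {ι : Type} [Fintype ι] (S : Op ι) : Prop :=
  ∃ u : ι → ZMod 2, S = opString pauliX u ∨ S = -opString pauliX u ∨
    S = opString pauliZ u ∨ S = -opString pauliZ u

/-- Pure CSS states `|ψ⟩⟨ψ|` of an `n`-qubit register: `ψ` is a unit vector which is, up to a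
scalar, the only vector stabilized by the group generated by some `n` CSS observables `g i`
(a vector is fixed by that group if and only if it is fixed by all the generators). -/
def IsPureCSS {ι : Type} [Fintype ι] [DecidableEq ι] (P : Op ι) : Prop :=
  ∃ (ψ : (ι → Fin 2) → ℂ) (g : ι → Op ι),
    star ψ ⬝ᵥ ψ = 1 ∧
    (∀ i, IsCSSObservable (g i)) ∧
    (∀ φ : (ι → Fin 2) → ℂ, (∀ i, (g i).mulVec φ = φ) ↔ ∃ c : ℂ, φ = c • ψ) ∧
    P = Matrix.vecMulVec ψ (star ψ)

/-- The set `D_css` of CSS states: the convex hull of the pure CSS states. -/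
def cssStates (ι : Type) [Fintype ι] [DecidableEq ι] : Set (Op ι) :=
  convexHull ℝ {P | IsPureCSS P}

/-- The interior of `D_css`.  All CSS states have trace one and are real symmetric, so the interior
is taken relative to the affine span of `D_css` (which is the space of all real symmetric
matrices of trace one). -/
def cssInterior (ι : Type) [Fintype ι] [DecidableEq ι] : Set (Op ι) :=
  intrinsicInterior ℝ (cssStates ι)

/-! ### Channels -/

/-- `(id_A ⊗ E)(M)` for `E` acting on the second part of the joint register `A ⊕ ι`. -/
def ampl {ι κ : Type} (A : Type) (E : Op ι →ₗ[ℂ] Op κ) (M : Op (A ⊕ ι)) : Op (A ⊕ κ) :=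
  Matrix.of fun x y =>
    E (Matrix.of fun p q => M (Sum.elim (x ∘ Sum.inl) p) (Sum.elim (y ∘ Sum.inl) q))
      (x ∘ Sum.inr) (y ∘ Sum.inr)

/-- Quantum channels: completely positive trace-preserving linear maps. -/
def IsChannel {ι κ : Type} [Fintype ι] [DecidableEq ι] [Fintype κ] [DecidableEq κ]
    (E : Op ι →ₗ[ℂ] Op κ) : Prop :=
  (∀ (k : ℕ) (M : Op (Fin k ⊕ ι)), M.PosSemidef → (ampl (Fin k) E M).PosSemidef) ∧
  (∀ M : Op ι, (E M).trace = M.trace)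

/-- Completely CSS-preserving protocols: channels `E` such that `id_A ⊗ E` maps CSS states to CSS
states, for every ancillary qubit register `A`. -/
def IsCompletelyCSSPreserving {ι κ : Type} [Fintype ι] [DecidableEq ι] [Fintype κ] [DecidableEq κ]
    (E : Op ι →ₗ[ℂ] Op κ) : Prop :=
  IsChannel E ∧
  ∀ (k : ℕ), ∀ M ∈ cssStates (Fin k ⊕ ι), ampl (Fin k) E M ∈ cssStates (Fin k ⊕ κ)

/-! ### The Wigner representation -/

/-- The phase space; a point is `u = (u_x, u_z)`. -/
abbrev PhaseSpace (ι : Type) : Type := (ι → ZMod 2) × (ι → ZMod 2)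

/-- The symplectic product `[u, v] = u_z · v_x - v_z · u_x`. -/
def symp {ι : Type} [Fintype ι] (u v : PhaseSpace ι) : ZMod 2 :=
  u.2 ⬝ᵥ v.1 - v.2 ⬝ᵥ u.1

/-- The displacement operators `D_u = Z(u_z) X(u_x)`. -/
def displacement {ι : Type} [Fintype ι] [DecidableEq ι] (u : PhaseSpace ι) : Op ι :=
  opString pauliZ u.2 * opString pauliX u.1

/-- The phase point operators `A_u = 2^{-n} ∑_v (-1)^{[u,v]} D_v`. -/
def phasePoint {ι : Type} [Fintype ι] [DecidableEq ι] (u : PhaseSpace ι) : Op ι :=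
  (1 / 2 ^ Fintype.card ι : ℂ) •
    ∑ v : PhaseSpace ι, ((-1 : ℂ) ^ (symp u v).val) • displacement v

/-- The (in general complex) representation `W_ρ(u) = 2^{-n} tr[A_u† ρ]`. -/
def wignerC {ι : Type} [Fintype ι] [DecidableEq ι] (ρ : Op ι) (u : PhaseSpace ι) : ℂ :=
  (1 / 2 ^ Fintype.card ι : ℂ) * ((phasePoint u).conjTranspose * ρ).trace

/-- `W_ρ` as a real function.  For rebit states `wignerC ρ` is real, so nothing is lost. -/
def wigner {ι : Type} [Fintype ι] [DecidableEq ι] (ρ : Op ι) (u : PhaseSpace ι) : ℝ :=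
  (wignerC ρ u).re

/-! ### Rényi divergences of quasiprobability distributions -/

/-- The set of orders `𝒜 = {2a/(2b-1) : a, b ∈ ℕ, a ≥ b ≥ 1} ∪ {∞}`. -/
def orders : Set EReal :=
  {α | ∃ a b : ℕ, 1 ≤ b ∧ b ≤ a ∧ α = ((2 * a / (2 * b - 1) : ℝ) : EReal)} ∪ {⊤}

/-- For an exponent `α = 2a/(2b-1)` the real power `w^α` is `|w|^α`, for `w` of either sign:
its `(2b-1)`-st power is `w^{2a}`. -/
theorem abs_rpow_order (w : ℝ) (a b : ℕ) (hb : 1 ≤ b) :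
    (|w| ^ (2 * a / (2 * b - 1) : ℝ)) ^ (2 * b - 1) = w ^ (2 * a) := by
  have hcast : ((2 * b - 1 : ℕ) : ℝ) = 2 * b - 1 := by
    rw [Nat.cast_sub (by omega)]
    push_cast
    ring
  have hb' : (1 : ℝ) ≤ b := by exact_mod_cast hb
  have hne : (2 * b - 1 : ℝ) ≠ 0 := by linarith
  rw [← Real.rpow_natCast, ← Real.rpow_mul (abs_nonneg w), hcast, div_mul_cancel₀ _ hne]
  have h2 : (2 * a : ℝ) = ((2 * a : ℕ) : ℝ) := by push_cast; ring
  rw [h2, Real.rpow_natCast, pow_mul, sq_abs, ← pow_mul]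

/-- The logarithm to base two, `[0, ∞] → [-∞, ∞]`. -/
def log2 (x : ENNReal) : EReal := ENNReal.log x / ((Real.log 2 : ℝ) : EReal)

/-- The `α`-Rényi divergence
`D_α(w‖r) = (α - 1)⁻¹ log ∑ᵢ wᵢ^α rᵢ^{1-α}` for finite `α ∈ 𝒜`, and
`D_∞(w‖r) = log maxᵢ |wᵢ| / rᵢ`, of a real vector `w` and a nonnegative vector `r`.
Here `wᵢ^α = |wᵢ|^α`.  An index with `rᵢ = 0` contributes `∞` if `wᵢ ≠ 0` and `0` if `wᵢ = 0`
(as in the arithmetic of `[0, ∞]`). -/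
def renyiDiv {Ω : Type} [Fintype Ω] (α : EReal) (w r : Ω → ℝ) : EReal :=
  open Classical in
  if α = ⊤ then log2 (⨆ i, ENNReal.ofReal |w i| / ENNReal.ofReal (r i))
  else log2 (∑ i, ENNReal.ofReal |w i| ^ α.toReal * ENNReal.ofReal (r i) ^ (1 - α.toReal))
    / ((α.toReal - 1 : ℝ) : EReal)

/-- `Λ_α(ρ) = inf_{τ ∈ D_css} D_α(W_ρ‖W_τ)`. -/
def cssMonotone {ι : Type} [Fintype ι] [DecidableEq ι] (α : EReal) (ρ : Op ι) : EReal :=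
  ⨅ τ ∈ cssStates ι, renyiDiv α (wigner ρ) (wigner τ)

end CSS

end

set_option linter.unusedSectionVars false

noncomputable section

namespace CSS

open scoped ComplexOrder

/-! ### Data processing and additivity of the Rényi divergences -/

/-! In the Wigner representation a completely CSS-preserving protocol is a stochastic matrix, so the
theorem is data processing for Rényi divergences.

The phase point operators are real, have trace one and expand every operator, so `E` acts on Wigner
functions with the kernel `S(v|u) = W_{E(A_u)}(v)` (`wignerC_map`). Up to a positive factor this is
the Wigner function of the Choi state at the joint point `(u, v)`. The maximally entangled state is
a pure CSS state, so the Choi state is a CSS state; CSS states have nonnegative Wigner functions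
(`IsPureCSS.wignerC_nonneg`), hence `S ≥ 0`. The columns of `S` sum to one because `E` preserves the
trace. CSS states are also real, so `E` preserves realness.

Every order in `𝒜` exceeds 1. For such orders data processing survives negative entries of `w`: the
triangle inequality reduces to `|w|`, and Hölder's inequality does the rest
(`renyiDiv_stochastic_le`). Wigner functions of tensor powers are products, and the divergence is
additive on products. Part (ii) follows since `E` maps CSS states to CSS states. -/

theorem one_lt_of_mem_orders {α : EReal} (hα : α ∈ orders) (h : α ≠ ⊤) : 1 < α.toReal := by
  rcases hα with ⟨a, b, hb, hab, rfl⟩ | h'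
  · rw [EReal.toReal_coe]
    have hb' : (1 : ℝ) ≤ b := by exact_mod_cast hb
    have hab' : (b : ℝ) ≤ a := by exact_mod_cast hab
    rw [lt_div_iff₀ (by linarith)]
    linarith
  · exact absurd h' h

theorem log2_mono : Monotone log2 := fun _ _ h =>
  EReal.div_le_div_right_of_nonneg (by exact_mod_cast (Real.log_pos one_lt_two).le)
    (ENNReal.log_monotone h)

theorem log2_pow (x : ENNReal) (n : ℕ) : log2 (x ^ n) = n * log2 x := by
  rw [log2, log2, ENNReal.log_pow, EReal.mul_div]

/-- The factorization that feeds Hölder's inequality: the powers of `b` cancel and those of `s` and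
`a` add up to one. When `b = 0`, finiteness of the right-hand term forces `s * a = 0`. -/
theorem mul_le_rpow_mul_rpow {p : ℝ} (hp : 1 < p) {s a b : ENNReal} (hs : s ≠ ⊤)
    (hb : b ≠ ⊤) (h : s * (a ^ p * b ^ (1 - p)) ≠ ⊤) :
    s * a ≤ (s * (a ^ p * b ^ (1 - p))) ^ (1 / p) * (s * b) ^ (1 - 1 / p) := by
  have hp0 : 0 < p := by linarith
  have hp1 : 0 < 1 - 1 / p := by rw [sub_pos, div_lt_one hp0]; exact hp
  rcases eq_or_ne s 0 with rfl | hs0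
  · simp
  rcases eq_or_ne b 0 with rfl | hb0
  · rcases eq_or_ne a 0 with rfl | ha0
    · simp
    · refine absurd ?_ h
      rw [ENNReal.zero_rpow_of_neg (by linarith), ENNReal.mul_top, ENNReal.mul_top hs0]
      simp [ha0, hp0.le]
  · rw [ENNReal.mul_rpow_of_nonneg _ _ (by positivity), ENNReal.mul_rpow_of_nonneg _ _ (by positivity),
      ENNReal.mul_rpow_of_nonneg _ _ hp1.le, ← ENNReal.rpow_mul, ← ENNReal.rpow_mul,
      mul_one_div_cancel hp0.ne', ENNReal.rpow_one]
    have h1 : s ^ (1 / p) * s ^ (1 - 1 / p) = s := by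
      rw [← ENNReal.rpow_add _ _ hs0 hs]; simp
    have h2 : b ^ ((1 - p) * (1 / p)) * b ^ (1 - 1 / p) = 1 := by
      rw [← ENNReal.rpow_add _ _ hb0 hb]
      have : (1 - p) * (1 / p) + (1 - 1 / p) = 0 := by field_simp; ring
      rw [this, ENNReal.rpow_zero]
    refine le_of_eq ?_
    calc s * a = (s ^ (1 / p) * s ^ (1 - 1 / p)) * a *
          (b ^ ((1 - p) * (1 / p)) * b ^ (1 - 1 / p)) := by rw [h1, h2, mul_one]
      _ = _ := by ring

/-- Hölder with exponent `p` and its conjugate `(1 - 1/p)⁻¹`, raised to the power `p`, then divided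
by the power `p - 1` of the reference sum. -/
theorem rpow_sum_mul_rpow_sum_le {Ω : Type} [Fintype Ω] {p : ℝ} (hp : 1 < p)
    {s a b : Ω → ENNReal} (hs : ∀ u, s u ≠ ⊤) (hb : ∀ u, b u ≠ ⊤) :
    (∑ u, s u * a u) ^ p * (∑ u, s u * b u) ^ (1 - p) ≤
      ∑ u, s u * (a u ^ p * b u ^ (1 - p)) := by
  have hp0 : 0 < p := by linarith
  set F := ∑ u, s u * (a u ^ p * b u ^ (1 - p)) with hF
  rcases eq_or_ne F ⊤ with hFt | hFt
  · rw [hFt]; exact le_top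
  have hterm : ∀ u, s u * (a u ^ p * b u ^ (1 - p)) ≠ ⊤ := fun u =>
    (ENNReal.sum_ne_top.1 hFt) u (Finset.mem_univ u)
  set B := ∑ u, s u * b u with hB
  have hBt : B ≠ ⊤ := ENNReal.sum_ne_top.2 fun u _ => ENNReal.mul_ne_top (hs u) (hb u)
  have hq : p.HolderConjugate (1 - 1 / p)⁻¹ := by
    rw [Real.holderConjugate_iff]
    refine ⟨hp, ?_⟩
    simp
  have key : ∑ u, s u * a u ≤ F ^ (1 / p) * B ^ (1 - 1 / p) := by
    calc ∑ u, s u * a u ≤ ∑ u, (s u * (a u ^ p * b u ^ (1 - p))) ^ (1 / p) *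
          (s u * b u) ^ (1 - 1 / p) :=
          Finset.sum_le_sum fun u _ => mul_le_rpow_mul_rpow hp (hs u) (hb u) (hterm u)
      _ ≤ _ := by
          refine (ENNReal.inner_le_Lp_mul_Lq _ _ _ hq).trans (le_of_eq ?_)
          have h3 : 1 - 1 / p ≠ 0 := by
            have : 0 < 1 - 1 / p := by rw [sub_pos, div_lt_one hp0]; exact hp
            exact this.ne'
          simp only [← ENNReal.rpow_mul, one_div_mul_cancel hp0.ne', mul_inv_cancel₀ h3,
            ENNReal.rpow_one]
          rw [one_div (1 - 1 / p)⁻¹, inv_inv]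
  have key' : (∑ u, s u * a u) ^ p ≤ F * B ^ (p - 1) := by
    refine (ENNReal.rpow_le_rpow key hp0.le).trans (le_of_eq ?_)
    rw [ENNReal.mul_rpow_of_nonneg _ _ hp0.le, ← ENNReal.rpow_mul, ← ENNReal.rpow_mul,
      one_div_mul_cancel hp0.ne', ENNReal.rpow_one]
    congr 2
    field_simp
  rcases eq_or_ne B 0 with hB0 | hB0
  -- Here `B ^ (1 - p) = ⊤`, but `key'` makes the other factor vanish, and `0 * ⊤ = 0`.
  · rw [hB0, ENNReal.zero_rpow_of_pos (by linarith), mul_zero, nonpos_iff_eq_zero] at key'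
    rw [key', zero_mul]; exact zero_le
  · refine (mul_le_mul_left key' _).trans (le_of_eq ?_)
    rw [mul_assoc, ← ENNReal.rpow_add _ _ hB0 hBt]
    simp

/-- The mediant inequality, which replaces Hölder at `α = ∞`. -/
theorem sum_div_sum_le_iSup {Ω : Type} [Fintype Ω] (s a b : Ω → ENNReal) (hb : ∀ u, b u ≠ ⊤) :
    (∑ u, s u * a u) / ∑ u, s u * b u ≤ ⨆ u, a u / b u := by
  rcases eq_or_ne (⨆ u, a u / b u) ⊤ with hM | hM
  · rw [hM]; exact le_top
  refine ENNReal.div_le_of_le_mul ?_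
  rw [Finset.mul_sum]
  refine Finset.sum_le_sum fun u _ => ?_
  have h : a u / b u ≤ ⨆ u, a u / b u := le_iSup (fun u => a u / b u) u
  rw [mul_left_comm]
  exact mul_le_mul_right
    ((ENNReal.div_le_iff_le_mul (Or.inr hM) (Or.inl (hb u))).1 h) _

/-- Data processing: a stochastic map does not increase the Rényi divergence of a
quasiprobability distribution from a nonnegative one. -/
theorem renyiDiv_stochastic_le {Ω Ω' : Type} [Fintype Ω] [Fintype Ω'] {S : Ω' → Ω → ℝ}
    (hS : ∀ v u, 0 ≤ S v u) (hsum : ∀ u, ∑ v, S v u = 1) (w : Ω → ℝ) {r : Ω → ℝ}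
    (hr : ∀ u, 0 ≤ r u) {α : EReal} (hα : α ∈ orders) :
    renyiDiv α (fun v => ∑ u, S v u * w u) (fun v => ∑ u, S v u * r u) ≤ renyiDiv α w r := by
  have habs : ∀ v, ENNReal.ofReal |∑ u, S v u * w u| ≤
      ∑ u, ENNReal.ofReal (S v u) * ENNReal.ofReal |w u| := fun v => by
    simp_rw [← ENNReal.ofReal_mul (hS v _)]
    rw [← ENNReal.ofReal_sum_of_nonneg fun u _ => mul_nonneg (hS v u) (abs_nonneg _)]
    refine ENNReal.ofReal_le_ofReal ((Finset.abs_sum_le_sum_abs _ _).trans (le_of_eq ?_))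
    exact Finset.sum_congr rfl fun u _ => by rw [abs_mul, abs_of_nonneg (hS v u)]
  have href : ∀ v, ENNReal.ofReal (∑ u, S v u * r u) =
      ∑ u, ENNReal.ofReal (S v u) * ENNReal.ofReal (r u) := fun v => by
    simp_rw [← ENNReal.ofReal_mul (hS v _)]
    rw [ENNReal.ofReal_sum_of_nonneg fun u _ => mul_nonneg (hS v u) (hr u)]
  rcases eq_or_ne α ⊤ with rfl | htop
  · simp only [renyiDiv, if_true]
    refine log2_mono (iSup_le fun v => ?_)
    rw [href]
    exact (ENNReal.div_le_div_right (habs v) _).trans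
      (sum_div_sum_le_iSup _ _ _ fun _ => ENNReal.ofReal_ne_top)
  · have hp := one_lt_of_mem_orders hα htop
    simp only [renyiDiv, if_neg htop]
    set p := α.toReal
    refine EReal.div_le_div_right_of_nonneg (by exact_mod_cast (by linarith : 0 ≤ p - 1))
      (log2_mono ?_)
    calc _ ≤ ∑ v, ∑ u, ENNReal.ofReal (S v u) *
          (ENNReal.ofReal |w u| ^ p * ENNReal.ofReal (r u) ^ (1 - p)) := by
          refine Finset.sum_le_sum fun v _ => ?_
          rw [href]
          exact (mul_le_mul_left (ENNReal.rpow_le_rpow (habs v) (by linarith)) _).trans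
            (rpow_sum_mul_rpow_sum_le hp (fun _ => ENNReal.ofReal_ne_top)
              fun _ => ENNReal.ofReal_ne_top)
      _ = _ := by
          rw [Finset.sum_comm]
          refine Finset.sum_congr rfl fun u _ => ?_
          rw [← Finset.sum_mul, ← ENNReal.ofReal_sum_of_nonneg fun v _ => hS v u, hsum,
            ENNReal.ofReal_one, one_mul]

theorem iSup_prod_fin {Ω : Type} (f : Ω → ENNReal) (n : ℕ) :
    ⨆ x : Fin n → Ω, ∏ k, f (x k) = (⨆ i, f i) ^ n := by
  induction n with
  | zero => simp
  | succ n ih =>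
    rw [← (Fin.consEquiv fun _ => Ω).iSup_comp, iSup_prod]
    simp only [Fin.consEquiv_apply, Fin.prod_univ_succ, Fin.cons_zero, Fin.cons_succ]
    simp_rw [← ENNReal.mul_iSup, ih, ← ENNReal.iSup_mul]
    rw [pow_succ']

/-- Finiteness matters because the exponent `1 - α` is negative: a factor `0` against a factor `⊤`
would break the identity. -/
theorem ennreal_prod_rpow {ι : Type} (s : Finset ι) (f : ι → ENNReal) (hf : ∀ i, f i ≠ ⊤)
    (p : ℝ) : (∏ i ∈ s, f i) ^ p = ∏ i ∈ s, f i ^ p := by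
  classical
  induction s using Finset.induction_on with
  | empty => simp
  | insert i s hi ih =>
    rw [Finset.prod_insert hi, Finset.prod_insert hi, ENNReal.mul_rpow_of_ne_top (hf i)
      (ENNReal.prod_ne_top fun j _ => hf j), ih]

/-- The Rényi divergences are additive: `D_α(w^{⊗n}‖r^{⊗n}) = n D_α(w‖r)`. -/
theorem renyiDiv_prod {Ω : Type} [Fintype Ω] {n : ℕ} (α : EReal) (w : Ω → ℝ) {r : Ω → ℝ}
    (hr : ∀ i, 0 ≤ r i) :
    renyiDiv α (fun x : Fin n → Ω => ∏ k, w (x k)) (fun x => ∏ k, r (x k)) =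
      n * renyiDiv α w r := by
  have hw' : ∀ x : Fin n → Ω, ENNReal.ofReal |∏ k, w (x k)| = ∏ k, ENNReal.ofReal |w (x k)| :=
    fun x => by rw [Finset.abs_prod, ENNReal.ofReal_prod_of_nonneg fun k _ => abs_nonneg _]
  have hr' : ∀ x : Fin n → Ω, ENNReal.ofReal (∏ k, r (x k)) = ∏ k, ENNReal.ofReal (r (x k)) :=
    fun x => ENNReal.ofReal_prod_of_nonneg fun k _ => hr _
  simp only [renyiDiv]
  split_ifs with h
  · rw [← log2_pow, ← iSup_prod_fin]
    congr 2 with x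
    rw [hw', hr', ENNReal.prod_div_distrib]
    · exact fun _ _ _ _ _ => Or.inr ENNReal.ofReal_ne_top
  · rw [EReal.mul_div, ← log2_pow]
    congr 2
    rw [← Fin.prod_const, Finset.prod_univ_sum, Fintype.piFinset_univ]
    refine Finset.sum_congr rfl fun x _ => ?_
    rw [hw', hr', ennreal_prod_rpow _ _ (fun _ => ENNReal.ofReal_ne_top),
      ennreal_prod_rpow _ _ (fun _ => ENNReal.ofReal_ne_top), Finset.prod_mul_distrib]

theorem renyiDiv_comp_equiv {Ω Ω' : Type} [Fintype Ω] [Fintype Ω'] (e : Ω' ≃ Ω) (α : EReal)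
    (w r : Ω → ℝ) : renyiDiv α (fun i => w (e i)) (fun i => r (e i)) = renyiDiv α w r := by
  simp only [renyiDiv]
  rw [e.iSup_comp (g := fun i => ENNReal.ofReal |w i| / ENNReal.ofReal (r i)),
    e.sum_comp (fun i => ENNReal.ofReal |w i| ^ α.toReal * ENNReal.ofReal (r i) ^ (1 - α.toReal))]

/-! ### Phase point operators -/

/-- The phase point operators of a single qubit. -/
def phasePointOne (a b : ZMod 2) : Matrix (Fin 2) (Fin 2) ℂ :=
  Matrix.of fun x y => if x.val = a.val then (-1) ^ (b.val * (x.val + y.val)) else 0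

theorem sum_zmod_two (f : ZMod 2 → ℂ) : ∑ a, f a = f 0 + f 1 := Fin.sum_univ_two f

theorem zmod_two_eq_zero_or_one : ∀ a : ZMod 2, a = 0 ∨ a = 1 := by decide

theorem sum_sum_symp_smul_pauli (a b : ZMod 2) (x y : Fin 2) :
    ∑ v : ZMod 2 × ZMod 2, (-1 : ℂ) ^ (b * v.1 - v.2 * a).val *
      (pauliZ ^ v.2.val * pauliX ^ v.1.val) x y = 2 * phasePointOne a b x y := by
  have hneg : (-1 : ZMod 2) = 1 := by decide
  rw [Fintype.sum_prod_type]
  simp only [sum_zmod_two]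
  rcases zmod_two_eq_zero_or_one a with rfl | rfl <;>
  rcases zmod_two_eq_zero_or_one b with rfl | rfl <;>
  fin_cases x <;> fin_cases y <;>
    norm_num [pauliX, pauliZ, phasePointOne, Matrix.one_apply, hneg, ZMod.val_one]

variable {ι κ : Type} [Fintype ι] [DecidableEq ι] [Fintype κ] [DecidableEq κ]

theorem neg_one_pow_val_sum (s : Finset ι) (f : ι → ZMod 2) :
    (-1 : ℂ) ^ (∑ i ∈ s, f i).val = ∏ i ∈ s, (-1 : ℂ) ^ (f i).val := by
  have hadd : ∀ a b : ZMod 2, (-1 : ℂ) ^ (a + b).val = (-1) ^ a.val * (-1) ^ b.val := by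
    intro a b
    rw [ZMod.val_add, ← pow_add, ← neg_one_pow_eq_pow_mod_two]
  induction s using Finset.induction_on with
  | empty => simp
  | insert i s hi ih => rw [Finset.sum_insert hi, Finset.prod_insert hi, hadd, ih]

theorem displacement_apply (v : PhaseSpace ι) (x y : ι → Fin 2) :
    displacement v x y =
      ∏ i, (pauliZ ^ (v.2 i).val * pauliX ^ (v.1 i).val) (x i) (y i) := by
  simp only [displacement, Matrix.mul_apply, opString, Matrix.of_apply, Finset.prod_univ_sum,
    Fintype.piFinset_univ, Finset.prod_mul_distrib]

/-- Both the symplectic sign and the displacement factor over the qubits, so the sum over phase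
space is a product of single-qubit sums; the factor 2 from each qubit cancels the normalization
`2^{-n}`. -/
theorem phasePoint_apply (u : PhaseSpace ι) (x y : ι → Fin 2) :
    phasePoint u x y = ∏ i, phasePointOne (u.1 i) (u.2 i) (x i) (y i) := by
  have h : ∀ v : PhaseSpace ι, (-1 : ℂ) ^ (symp u v).val * displacement v x y =
      ∏ i, ((-1 : ℂ) ^ (u.2 i * v.1 i - v.2 i * u.1 i).val *
        (pauliZ ^ (v.2 i).val * pauliX ^ (v.1 i).val) (x i) (y i)) := fun v => by
    rw [Finset.prod_mul_distrib, ← neg_one_pow_val_sum, displacement_apply, symp, dotProduct,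
      dotProduct, Finset.sum_sub_distrib]
  simp only [phasePoint, Matrix.smul_apply, Matrix.sum_apply, smul_eq_mul, h]
  rw [← (Equiv.arrowProdEquivProdArrow ι (fun _ => ZMod 2) (fun _ => ZMod 2)).sum_comp]
  simp only [Equiv.arrowProdEquivProdArrow, Equiv.coe_fn_mk]
  have h2 := Finset.prod_univ_sum (fun _ : ι => (Finset.univ : Finset (ZMod 2 × ZMod 2)))
    (fun i v => (-1 : ℂ) ^ (u.2 i * v.1 - v.2 * u.1 i).val *
        (pauliZ ^ v.2.val * pauliX ^ v.1.val) (x i) (y i))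
  rw [Fintype.piFinset_univ] at h2
  rw [← h2]
  simp only [sum_sum_symp_smul_pauli, Finset.prod_mul_distrib, Finset.prod_const,
    Finset.card_univ]
  field_simp

theorem star_phasePoint_apply (u : PhaseSpace ι) (x y : ι → Fin 2) :
    star (phasePoint u x y) = phasePoint u x y := by
  rw [phasePoint_apply, star_prod]
  refine Finset.prod_congr rfl fun i _ => ?_
  simp only [phasePointOne, Matrix.of_apply]
  split_ifs <;> simp

theorem wignerC_eq_sum (M : Op ι) (u : PhaseSpace ι) :
    wignerC M u = (1 / 2 ^ Fintype.card ι : ℂ) * ∑ x, ∑ y, phasePoint u x y * M x y := by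
  rw [wignerC, Matrix.trace]
  simp only [Matrix.diag_apply, Matrix.mul_apply, Matrix.conjTranspose_apply,
    star_phasePoint_apply]
  rw [Finset.sum_comm]

theorem sum_phaseSpace_prod (f : ι → ZMod 2 → ZMod 2 → ℂ) :
    ∑ u : PhaseSpace ι, ∏ i, f i (u.1 i) (u.2 i) = ∏ i, ∑ a, ∑ b, f i a b := by
  rw [← (Equiv.arrowProdEquivProdArrow ι (fun _ => ZMod 2) (fun _ => ZMod 2)).sum_comp]
  simp only [← Fintype.sum_prod_type', Finset.prod_univ_sum, Fintype.piFinset_univ,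
    Equiv.arrowProdEquivProdArrow, Equiv.coe_fn_mk]

theorem trace_phasePoint (u : PhaseSpace ι) : (phasePoint u).trace = 1 := by
  simp only [Matrix.trace, Matrix.diag_apply, phasePoint_apply]
  have h := Finset.prod_univ_sum (fun _ : ι => (Finset.univ : Finset (Fin 2)))
    (fun i x => phasePointOne (u.1 i) (u.2 i) x x)
  rw [Fintype.piFinset_univ] at h
  rw [← h]
  refine Finset.prod_eq_one fun i _ => ?_
  rw [Fin.sum_univ_two]
  rcases zmod_two_eq_zero_or_one (u.1 i) with h | h <;> rw [h] <;>
  rcases zmod_two_eq_zero_or_one (u.2 i) with h' | h' <;> rw [h'] <;>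
    norm_num [phasePointOne, ZMod.val_one]

/-- Completeness relation, reduced to one qubit by the product form. Since the entries are real, no
conjugate appears. It gives the expansion of any operator in phase point operators. -/
theorem sum_phasePoint_mul_phasePoint (x y x' y' : ι → Fin 2) :
    ∑ u : PhaseSpace ι, phasePoint u x y * phasePoint u x' y' =
      if x = x' ∧ y = y' then 2 ^ Fintype.card ι else 0 := by
  have h1 : ∀ x y x' y' : Fin 2, ∑ a, ∑ b, phasePointOne a b x y * phasePointOne a b x' y' =
      if x = x' ∧ y = y' then 2 else 0 := by
    intro x y x' y'
    simp only [sum_zmod_two]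
    fin_cases x <;> fin_cases y <;> fin_cases x' <;> fin_cases y' <;>
      norm_num [phasePointOne, ZMod.val_one]
  simp only [phasePoint_apply, ← Finset.prod_mul_distrib]
  rw [sum_phaseSpace_prod fun i a b =>
    phasePointOne a b (x i) (y i) * phasePointOne a b (x' i) (y' i)]
  simp only [h1, Finset.prod_ite_zero, Finset.mem_univ, true_imp_iff, funext_iff,
    Finset.prod_const, Finset.card_univ, forall_and]

theorem sum_wignerC_smul_phasePoint (M : Op ι) :
    ∑ u : PhaseSpace ι, wignerC M u • phasePoint u = M := by
  ext x y
  simp only [Matrix.sum_apply, Matrix.smul_apply, smul_eq_mul, wignerC_eq_sum, mul_assoc,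
    Finset.sum_mul]
  rw [← Finset.mul_sum, Finset.sum_comm]
  have h : ∀ x', ∑ u : PhaseSpace ι, ∑ y', phasePoint u x' y' * (M x' y' * phasePoint u x y) =
      ∑ y', (if x' = x ∧ y' = y then 2 ^ Fintype.card ι else 0) * M x' y' := fun x' => by
    rw [Finset.sum_comm]
    refine Finset.sum_congr rfl fun y' _ => ?_
    rw [← sum_phasePoint_mul_phasePoint, Finset.sum_mul]
    exact Finset.sum_congr rfl fun u _ => by ring
  simp only [h, ite_and]
  simp

theorem sum_wignerC (M : Op ι) : ∑ u : PhaseSpace ι, wignerC M u = M.trace := by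
  conv_rhs => rw [← sum_wignerC_smul_phasePoint M]
  simp only [Matrix.trace_sum, Matrix.trace_smul, trace_phasePoint, smul_eq_mul, mul_one]

theorem wignerC_im {M : Op ι} (hM : ∀ x y, (M x y).im = 0) (u : PhaseSpace ι) :
    (wignerC M u).im = 0 := by
  have h : star (wignerC M u) = wignerC M u := by
    rw [wignerC_eq_sum]
    simp only [star_mul', star_sum, star_phasePoint_apply]
    have hs : ∀ x y, star (M x y) = M x y := fun x y => Complex.conj_eq_iff_im.2 (hM x y)
    simp only [hs]
    simp
  exact Complex.conj_eq_iff_im.1 h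

theorem wignerC_eq_wigner {M : Op ι} (hM : ∀ x y, (M x y).im = 0) (u : PhaseSpace ι) :
    wignerC M u = (wigner M u : ℂ) :=
  Complex.ext (by simp [wigner]) (by simp [wignerC_im hM])

/-! ### CSS states -/

/-- A binary vector as a computational basis vector. -/
def toBits (u : ι → ZMod 2) : ι → Fin 2 := u

theorem opString_pauliX_apply (u : ι → ZMod 2) (x y : ι → Fin 2) :
    opString pauliX u x y = if y = x + toBits u then 1 else 0 := by
  have h : ∀ a x y : Fin 2, (pauliX ^ a.val) x y = if y = x + a then 1 else 0 := by
    intro a x y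
    fin_cases a <;> fin_cases x <;> fin_cases y <;> simp [pauliX]
  have h' : ∀ i, (pauliX ^ (u i).val) (x i) (y i) =
    if y i = x i + toBits u i then 1 else 0 := fun i => h (u i) (x i) (y i)
  simp only [opString, Matrix.of_apply, h', Finset.prod_boole, Finset.mem_univ, true_imp_iff,
    funext_iff, Pi.add_apply]

/-- The character `(-1)^{b·x}`. -/
def zsign (b : ι → ZMod 2) (x : ι → Fin 2) : ℝ := ∏ i, (-1) ^ ((b i).val * (x i).val)

theorem opString_pauliZ_apply (u : ι → ZMod 2) (x y : ι → Fin 2) :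
    opString pauliZ u x y = if x = y then (zsign u x : ℂ) else 0 := by
  have h : ∀ (a : ZMod 2) (x y : Fin 2), (pauliZ ^ a.val) x y =
      if x = y then (-1) ^ (a.val * x.val) else 0 := by
    change ∀ a x y : Fin 2, _
    intro a x y
    fin_cases a <;> fin_cases x <;> fin_cases y <;> simp [pauliZ, ZMod.val]
  simp only [opString, Matrix.of_apply, h, Finset.prod_ite_zero, Finset.mem_univ, true_imp_iff,
    funext_iff, zsign]
  push_cast
  rfl

theorem opString_pauliX_mulVec (u : ι → ZMod 2) (φ : (ι → Fin 2) → ℂ) (x : ι → Fin 2) :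
    (opString pauliX u).mulVec φ x = φ (x + toBits u) := by
  simp [Matrix.mulVec, dotProduct, opString_pauliX_apply]

theorem opString_pauliZ_mulVec (u : ι → ZMod 2) (φ : (ι → Fin 2) → ℂ) (x : ι → Fin 2) :
    (opString pauliZ u).mulVec φ x = zsign u x * φ x := by
  simp [Matrix.mulVec, dotProduct, opString_pauliZ_apply]

theorem zsign_add (b : ι → ZMod 2) (x y : ι → Fin 2) :
    zsign b (x + y) = zsign b x * zsign b y := by
  rw [zsign, zsign, zsign, ← Finset.prod_mul_distrib]
  refine Finset.prod_congr rfl fun i _ => ?_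
  rw [← pow_add, Pi.add_apply, Fin.val_add, ← mul_add, pow_mul, pow_mul]
  rcases neg_one_pow_eq_or ℝ (b i).val with h | h
  · simp [h]
  · rw [h, ← neg_one_pow_eq_pow_mod_two]

theorem zsign_eq_or (b : ι → ZMod 2) (x : ι → Fin 2) : zsign b x = 1 ∨ zsign b x = -1 := by
  rw [zsign, Finset.prod_pow_eq_pow_sum]
  exact neg_one_pow_eq_or ℝ _

/-- All that the support argument uses: `X`-type observables translate up to a sign, `Z`-type ones
are diagonal. -/
theorem IsCSSObservable.mulVec_eq {S : Op ι} (hS : IsCSSObservable S) :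
    (∃ (a : ι → Fin 2) (ε : ℝ), (ε = 1 ∨ ε = -1) ∧ ∀ φ x, S.mulVec φ x = ε * φ (x + a)) ∨
    ∃ d : (ι → Fin 2) → ℝ, ∀ φ x, S.mulVec φ x = d x * φ x := by
  obtain ⟨u, rfl | rfl | rfl | rfl⟩ := hS
  · exact Or.inl ⟨toBits u, 1, Or.inl rfl, fun φ x => by simp [opString_pauliX_mulVec]⟩
  · exact Or.inl ⟨toBits u, -1, Or.inr rfl, fun φ x => by simp [Matrix.neg_mulVec, opString_pauliX_mulVec]⟩
  · exact Or.inr ⟨zsign u, fun φ x => opString_pauliZ_mulVec u φ x⟩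
  · exact Or.inr ⟨fun x => -zsign u x, fun φ x => by
      simp [Matrix.neg_mulVec, opString_pauliZ_mulVec]⟩

/-- The translations that preserve a vector up to a sign. -/
def signedPeriods (ψ : (ι → Fin 2) → ℂ) : AddSubgroup (ι → Fin 2) where
  carrier := {a | ∃ ε : ℝ, (ε = 1 ∨ ε = -1) ∧ ∀ x, ψ (x + a) = ε * ψ x}
  zero_mem' := ⟨1, Or.inl rfl, by simp⟩
  add_mem' := by
    rintro a b ⟨ε, hε, ha⟩ ⟨δ, hδ, hb⟩
    refine ⟨δ * ε, ?_, fun x => ?_⟩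
    · rcases hε with rfl | rfl <;> rcases hδ with rfl | rfl <;> simp
    · rw [← add_assoc, hb, ha]; push_cast; ring
  neg_mem' := by
    rintro a ⟨ε, hε, ha⟩
    refine ⟨ε, hε, fun x => ?_⟩
    have h := ha (x + -a)
    rw [neg_add_cancel_right] at h
    rw [h]
    rcases hε with rfl | rfl <;> simp

/-- The support of a vector defining a pure CSS state is a coset of its signed periods. -/
theorem mem_signedPeriods_of_ne_zero {ψ : (ι → Fin 2) → ℂ} {g : ι → Op ι}
    (hg : ∀ i, IsCSSObservable (g i))
    (hψ : ∀ φ : (ι → Fin 2) → ℂ, (∀ i, (g i).mulVec φ = φ) ↔ ∃ c : ℂ, φ = c • ψ)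
    {x y : ι → Fin 2} (hx : ψ x ≠ 0) (hy : ψ y ≠ 0) : y - x ∈ signedPeriods ψ := by
  classical
  by_contra hxy
  have hfix : ∀ i, (g i).mulVec ψ = ψ := (hψ ψ).2 ⟨1, by simp⟩
  -- Cut `ψ` down to the coset of `x`. The generators still fix it, as translations stay within
  -- cosets and diagonal operators act pointwise. By uniqueness it is `c • ψ`, yet it agrees with
  -- `ψ` at `x` and vanishes at `y`.
  obtain ⟨c, hc⟩ := (hψ fun z => if z - x ∈ signedPeriods ψ then ψ z else 0).1 fun i => by
    ext z
    have hi := congrFun (hfix i) z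
    rcases (hg i).mulVec_eq with ⟨a, ε, hε, h⟩ | ⟨d, h⟩
    · have ha : a ∈ signedPeriods ψ := ⟨ε, hε, fun z => by
        have hz := congrFun (hfix i) z
        rw [h] at hz
        rw [← hz]
        rcases hε with rfl | rfl <;> simp⟩
      rw [h] at hi ⊢
      have : z + a - x ∈ signedPeriods ψ ↔ z - x ∈ signedPeriods ψ := by
        rw [add_sub_right_comm]
        exact (signedPeriods ψ).add_mem_cancel_right ha
      simp only [this]
      split_ifs
      · exact hi
      · simp
    · rw [h] at hi ⊢
      split_ifs
      · exact hi
      · simp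
  have h1 := congrFun hc x
  have h2 := congrFun hc y
  simp only [sub_self, (signedPeriods ψ).zero_mem, if_true, if_neg hxy, Pi.smul_apply,
    smul_eq_mul] at h1 h2
  rcases mul_eq_zero.1 h2.symm with h | h
  · rw [h, zero_mul] at h1; exact hx h1
  · exact hy h

/-- On the support the values of `ψ` differ only by signs, so each nonzero entry is `±|ψ x|²`. -/
theorem IsPureCSS.im_eq_zero {P : Op ι} (hP : IsPureCSS P) (x y : ι → Fin 2) :
    (P x y).im = 0 := by
  obtain ⟨ψ, g, -, hg, hψ, rfl⟩ := hP
  rw [Matrix.vecMulVec_apply, Pi.star_apply]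
  by_cases hx : ψ x = 0
  · simp [hx]
  by_cases hy : ψ y = 0
  · simp [hy]
  obtain ⟨ε, -, h⟩ := mem_signedPeriods_of_ne_zero hg hψ hx hy
  have h := h x
  rw [add_sub_cancel] at h
  rw [h]
  simp
  ring

theorem phasePoint_apply_eq_zsign (u : PhaseSpace ι) (x y : ι → Fin 2) :
    phasePoint u x y = if x = toBits u.1 then (zsign u.2 (x + y) : ℂ) else 0 := by
  rw [phasePoint_apply, zsign_add, zsign, zsign, ← Finset.prod_mul_distrib]
  have h : ∀ i, (x i).val = (u.1 i).val ↔ x i = toBits u.1 i := fun i =>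
    (Fin.ext_iff (a := x i) (b := toBits u.1 i)).symm
  simp only [phasePointOne, Matrix.of_apply, Finset.prod_ite_zero, Finset.mem_univ, true_imp_iff,
    h, funext_iff]
  congr 1
  push_cast
  exact Finset.prod_congr rfl fun i _ => by rw [mul_add, pow_add]

/-- Only the row `x = u_x` contributes, giving a character sum over the support, a coset of the
signed periods. If the character times the sign of `ψ` equals `-1` at some period, translating by it
gives `T = -T`; otherwise every nonzero term is `|ψ x|²`. -/
theorem IsPureCSS.wignerC_nonneg {P : Op ι} (hP : IsPureCSS P) (u : PhaseSpace ι) :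
    0 ≤ wignerC P u := by
  obtain ⟨ψ, g, -, hg, hψ, rfl⟩ := hP
  rw [wignerC_eq_sum]
  have hcoef : (0 : ℂ) ≤ 1 / 2 ^ Fintype.card ι := by positivity
  refine mul_nonneg hcoef ?_
  simp only [phasePoint_apply_eq_zsign, Matrix.vecMulVec_apply, Pi.star_apply, ite_mul, zero_mul]
  rw [Finset.sum_comm]
  simp only [Finset.sum_ite_eq', Finset.mem_univ, if_true]
  generalize toBits u.1 = x
  generalize u.2 = b
  by_cases hx : ψ x = 0
  · simp [hx]
  set T := ∑ y, (zsign b (x + y) : ℂ) * (ψ x * star (ψ y)) with hT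
  by_cases hneg : ∃ a, ∃ ε : ℝ, (∀ z, ψ (z + a) = ε * ψ z) ∧ zsign b a * ε = -1
  · obtain ⟨a, ε, ha, hε⟩ := hneg
    have h1 : T = ((zsign b a * ε : ℝ) : ℂ) * T := by
      rw [hT, Finset.mul_sum, ← Equiv.sum_comp (Equiv.addRight a)]
      refine Finset.sum_congr rfl fun y _ => ?_
      rw [Equiv.coe_addRight, ha, ← add_assoc, zsign_add]
      simp
      ring
    rw [hε] at h1
    have h2 : T = 0 := by
      push_cast at h1
      linear_combination (1 / 2 : ℂ) * h1
    rw [h2]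
  · refine Finset.sum_nonneg fun y _ => ?_
    by_cases hy : ψ y = 0
    · simp [hy]
    obtain ⟨ε, hε, h⟩ := mem_signedPeriods_of_ne_zero hg hψ hx hy
    have hpos : zsign b (y - x) * ε = 1 := by
      rcases zsign_eq_or b (y - x) with h1 | h1 <;> rcases hε with rfl | rfl <;>
        first
          | (rw [h1]; norm_num; done)
          | exact absurd ⟨_, _, h, by rw [h1]; norm_num⟩ hneg
    have hxy : zsign b (x + y) = zsign b (y - x) := by
      have hx2 : zsign b (x + x) = 1 := by
        rw [zsign_add]; rcases zsign_eq_or b x with h1 | h1 <;> rw [h1] <;> norm_num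
      have : x + y = (y - x) + (x + x) := by abel
      rw [this, zsign_add, hx2, mul_one]
    have hyx := h x
    rw [add_sub_cancel] at hyx
    have : (zsign b (x + y) : ℂ) * (ψ x * star (ψ y)) = ψ x * star (ψ x) := by
      have h3 : (zsign b (y - x) : ℂ) * ε = 1 := by exact_mod_cast hpos
      rw [hxy, hyx, star_mul']
      have : star (ε : ℂ) = ε := Complex.conj_ofReal ε
      rw [this]
      linear_combination (ψ x * star (ψ x)) * h3
    rw [this]
    exact mul_star_self_nonneg _

theorem im_eq_zero_of_mem_cssStates {P : Op ι} (hP : P ∈ cssStates ι) (x y : ι → Fin 2) :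
    (P x y).im = 0 := by
  have hconv : Convex ℝ {P : Op ι | (P x y).im = 0} := by
    intro P hP Q hQ a b _ _ _
    simp only [Set.mem_ofPred_eq] at hP hQ ⊢
    simp [hP, hQ]
  exact convexHull_min (fun P hP => IsPureCSS.im_eq_zero hP x y) hconv hP

theorem wignerC_add_smul (a b : ℂ) (M N : Op ι) (u : PhaseSpace ι) :
    wignerC (a • M + b • N) u = a * wignerC M u + b * wignerC N u := by
  simp only [wignerC, Matrix.mul_add, Matrix.mul_smul, Matrix.trace_add, Matrix.trace_smul,
    smul_eq_mul]
  ring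

theorem wignerC_nonneg_of_mem_cssStates {P : Op ι} (hP : P ∈ cssStates ι) (u : PhaseSpace ι) :
    0 ≤ wignerC P u := by
  have hconv : Convex ℝ {P : Op ι | 0 ≤ wignerC P u} := by
    intro P hP Q hQ a b ha hb _
    simp only [Set.mem_ofPred_eq] at hP hQ ⊢
    have h := wignerC_add_smul (a : ℂ) (b : ℂ) P Q u
    simp only [Complex.coe_smul] at h
    rw [h]
    exact add_nonneg (mul_nonneg (by exact_mod_cast ha) hP) (mul_nonneg (by exact_mod_cast hb) hQ)
  exact convexHull_min (fun P hP => IsPureCSS.wignerC_nonneg hP u) hconv hP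

theorem wigner_nonneg_of_mem_cssStates {P : Op ι} (hP : P ∈ cssStates ι) (u : PhaseSpace ι) :
    0 ≤ wigner P u :=
  (Complex.le_def.1 (wignerC_nonneg_of_mem_cssStates hP u)).1

/-! ### Relabelling the qubits of a register -/

/-- The bijection of computational bases induced by a bijection of registers. -/
def relabel {ι κ : Type} (e : ι ≃ κ) : (ι → Fin 2) ≃ (κ → Fin 2) := e.arrowCongr (Equiv.refl _)

theorem IsCSSObservable.relabel {S : Op κ} (hS : IsCSSObservable S) (e : ι ≃ κ) :
    IsCSSObservable (S.submatrix (relabel e) (relabel e)) := by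
  have h : ∀ (O : Matrix (Fin 2) (Fin 2) ℂ) (u : κ → ZMod 2),
      (opString O u).submatrix (CSS.relabel e) (CSS.relabel e) = opString O (u ∘ e) := by
    intro O u
    ext x y
    simp only [opString, Matrix.submatrix_apply, Matrix.of_apply]
    rw [← e.prod_comp]
    simp [CSS.relabel]
  obtain ⟨u, rfl | rfl | rfl | rfl⟩ := hS <;> refine ⟨u ∘ e, ?_⟩ <;>
    simp only [Matrix.submatrix_neg, Pi.neg_apply, h, true_or, or_true]

theorem IsPureCSS.relabel {P : Op κ} (hP : IsPureCSS P) (e : ι ≃ κ) :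
    IsPureCSS (P.submatrix (relabel e) (relabel e)) := by
  obtain ⟨ψ, g, hnorm, hg, hψ, rfl⟩ := hP
  refine ⟨ψ ∘ CSS.relabel e, fun i => (g (e i)).submatrix (CSS.relabel e) (CSS.relabel e), ?_,
    fun i => (hg _).relabel e, fun φ => ?_, ?_⟩
  · rw [← hnorm]
    exact (CSS.relabel e).sum_comp fun x => star ψ x * ψ x
  · simp only [Matrix.submatrix_mulVec_equiv]
    have h1 : (∀ i, (g (e i)).mulVec (φ ∘ (CSS.relabel e).symm) ∘ CSS.relabel e = φ) ↔
        ∀ k, (g k).mulVec (φ ∘ (CSS.relabel e).symm) = φ ∘ (CSS.relabel e).symm := by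
      rw [← e.forall_congr_right]
      refine forall_congr' fun i => ?_
      rw [Equiv.eq_comp_symm]
    rw [h1, hψ]
    refine exists_congr fun c => ?_
    rw [Equiv.comp_symm_eq]
    rfl
  · ext x y
    simp [Matrix.vecMulVec_apply]

theorem submatrix_relabel_mem_cssStates {P : Op κ} (hP : P ∈ cssStates κ) (e : ι ≃ κ) :
    P.submatrix (relabel e) (relabel e) ∈ cssStates ι := by
  have hconv : Convex ℝ {P : Op κ | P.submatrix (relabel e) (relabel e) ∈ cssStates ι} :=
    fun P hP Q hQ a b ha hb hab => convex_convexHull ℝ _ hP hQ ha hb hab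
  have hsub : {P : Op κ | IsPureCSS P} ⊆
      {P : Op κ | P.submatrix (relabel e) (relabel e) ∈ cssStates ι} := fun P hP =>
    subset_convexHull ℝ {P : Op ι | IsPureCSS P} (IsPureCSS.relabel (P := P) hP e)
  exact convexHull_min hsub hconv hP

theorem submatrix_relabel_symm (P : Op κ) (e : ι ≃ κ) :
    (P.submatrix (relabel e) (relabel e)).submatrix (relabel e.symm) (relabel e.symm) = P := by
  have h : ∀ x : κ → Fin 2, relabel e (relabel e.symm x) = x := fun x => by
    funext i
    simp [relabel, Equiv.arrowCongr]
  ext x y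
  rw [Matrix.submatrix_apply, Matrix.submatrix_apply, h, h]

/-- Passes from ancillas `Fin k` to any finite register, in particular to the copy of the input
register needed for the Choi state. -/
theorem IsCompletelyCSSPreserving.ampl_mem {A : Type} [Fintype A] [DecidableEq A]
    {E : Op ι →ₗ[ℂ] Op κ}
    (hE : IsCompletelyCSSPreserving E) {M : Op (A ⊕ ι)} (hM : M ∈ cssStates (A ⊕ ι)) :
    ampl A E M ∈ cssStates (A ⊕ κ) := by
  let e : Fin (Fintype.card A) ≃ A := (Fintype.equivFin A).symm
  have h := submatrix_relabel_mem_cssStates (hE.2 _ _ (submatrix_relabel_mem_cssStates hM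
    (e.sumCongr (Equiv.refl ι)))) (e.sumCongr (Equiv.refl κ)).symm
  have hkey : ampl (Fin (Fintype.card A)) E (M.submatrix (relabel (e.sumCongr (Equiv.refl ι)))
      (relabel (e.sumCongr (Equiv.refl ι)))) =
      (ampl A E M).submatrix (relabel (e.sumCongr (Equiv.refl κ)))
        (relabel (e.sumCongr (Equiv.refl κ))) := by
    ext x y
    simp only [ampl, Matrix.of_apply, Matrix.submatrix_apply]
    have h1 : ∀ (x : Fin (Fintype.card A) ⊕ κ → Fin 2) (p : ι → Fin 2),
        relabel (e.sumCongr (Equiv.refl ι)) (Sum.elim (x ∘ Sum.inl) p) =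
        Sum.elim (relabel (e.sumCongr (Equiv.refl κ)) x ∘ Sum.inl) p := by
      intro x p
      funext j
      cases j <;> rfl
    simp only [h1]
    rfl
  rwa [hkey, submatrix_relabel_symm] at h

/-- The empty ancilla turns the complete conditions into statements about `E` itself. -/
theorem ampl_fin_zero (E : Op ι →ₗ[ℂ] Op κ) (M : Op ι) :
    ampl (Fin 0) E (M.submatrix (relabel (Equiv.emptySum (Fin 0) ι))
      (relabel (Equiv.emptySum (Fin 0) ι))) =
      (E M).submatrix (relabel (Equiv.emptySum (Fin 0) κ))
        (relabel (Equiv.emptySum (Fin 0) κ)) := by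
  ext x y
  rfl

theorem IsCompletelyCSSPreserving.map_mem {E : Op ι →ₗ[ℂ] Op κ}
    (hE : IsCompletelyCSSPreserving E) {M : Op ι} (hM : M ∈ cssStates ι) :
    E M ∈ cssStates κ := by
  have h := hE.2 0 _ (submatrix_relabel_mem_cssStates hM (Equiv.emptySum (Fin 0) ι))
  rw [ampl_fin_zero] at h
  have h' := submatrix_relabel_mem_cssStates h (Equiv.emptySum (Fin 0) κ).symm
  rwa [submatrix_relabel_symm] at h'

theorem IsChannel.isState {E : Op ι →ₗ[ℂ] Op κ} (hE : IsChannel E) {M : Op ι} (hM : IsState M) :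
    IsState (E M) := by
  refine ⟨?_, by rw [hE.2, hM.2]⟩
  have h := hE.1 0 _ (hM.1.submatrix (relabel (Equiv.emptySum (Fin 0) ι)))
  rw [ampl_fin_zero] at h
  have h' := h.submatrix (relabel (Equiv.emptySum (Fin 0) κ).symm)
  rwa [submatrix_relabel_symm] at h'

/-! ### The maximally entangled state -/

/-- The maximally entangled state vector of two copies of a register. -/
def maxEntangledVec (ι : Type) [Fintype ι] [DecidableEq ι] (x : ι ⊕ ι → Fin 2) : ℂ :=
  if x ∘ Sum.inl = x ∘ Sum.inr then ((√(2 ^ Fintype.card ι))⁻¹ : ℝ) else 0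

/-- The maximally entangled state of two copies of a register. -/
def maxEntangled (ι : Type) [Fintype ι] [DecidableEq ι] : Op (ι ⊕ ι) :=
  Matrix.vecMulVec (maxEntangledVec ι) (star (maxEntangledVec ι))

theorem maxEntangledVec_coeff_mul_self :
    (((√(2 ^ Fintype.card ι))⁻¹ : ℝ) : ℂ) * ((√(2 ^ Fintype.card ι))⁻¹ : ℝ) =
      1 / 2 ^ Fintype.card ι := by
  rw [← Complex.ofReal_mul, ← mul_inv, Real.mul_self_sqrt (by positivity)]
  push_cast
  rw [one_div]

theorem maxEntangled_apply (x y p q : ι → Fin 2) :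
    maxEntangled ι (Sum.elim x p) (Sum.elim y q) =
      if x = p ∧ y = q then 1 / 2 ^ Fintype.card ι else 0 := by
  rw [← maxEntangledVec_coeff_mul_self]
  simp only [maxEntangled, Matrix.vecMulVec_apply, maxEntangledVec, Sum.elim_comp_inl,
    Sum.elim_comp_inr, Pi.star_apply, ite_and]
  by_cases hx : x = p <;> by_cases hy : y = q <;> simp [hx, hy]

/-- The binary vector with ones at the two copies of the qubit `i`. -/
def pairVec (i : ι) : ι ⊕ ι → ZMod 2 := Sum.elim (Pi.single i 1) (Pi.single i 1)

theorem toBits_pairVec (i : ι) :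
    toBits (pairVec i) = Sum.elim (Pi.single i 1 : ι → Fin 2) (Pi.single i 1) := rfl

theorem zsign_pairVec (i : ι) (x : ι ⊕ ι → Fin 2) :
    zsign (pairVec i) x = (-1) ^ ((x (Sum.inl i)).val + (x (Sum.inr i)).val) := by
  have h : ∀ y : ι → Fin 2, ∏ j, (-1 : ℝ) ^ (((Pi.single i 1 : ι → ZMod 2) j).val * (y j).val) =
      (-1) ^ (y i).val := by
    intro y
    rw [Finset.prod_eq_single i]
    · simp [ZMod.val_one]
    · intro j _ hj
      simp [hj]
    · simp
  rw [zsign, Fintype.prod_sum_type, pow_add]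
  exact congrArg₂ _ (h fun j => x (Sum.inl j)) (h fun j => x (Sum.inr j))

theorem eq_of_forall_add_single {F : (ι → Fin 2) → ℂ}
    (h : ∀ i x, F (x + Pi.single i 1) = F x) (x : ι → Fin 2) : F x = F 0 := by
  have key : ∀ s : Finset ι, F (∑ i ∈ s, Pi.single i (x i)) = F 0 := by
    intro s
    induction s using Finset.induction_on with
    | empty => simp
    | insert i s hi ih =>
      rw [Finset.sum_insert hi, add_comm]
      have h01 : ∀ a : Fin 2, a = 0 ∨ a = 1 := by decide
      rcases h01 (x i) with h0 | h1
      · rw [h0, Pi.single_zero, add_zero, ih]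
      · rw [h1, h, ih]
  have := key Finset.univ
  rwa [Finset.univ_sum_single] at this

/-- The stabilizers are `XX` and `ZZ` on each pair of corresponding qubits: the `ZZ` confine a fixed
vector to the diagonal, the `XX` make it constant there. -/
theorem isPureCSS_maxEntangled : IsPureCSS (maxEntangled ι) := by
  refine ⟨maxEntangledVec ι, Sum.elim (fun i => opString pauliX (pairVec i))
    (fun i => opString pauliZ (pairVec i)), ?_, ?_, ?_, rfl⟩
  · rw [dotProduct, ← (Equiv.sumArrowEquivProdArrow ι ι (Fin 2)).symm.sum_comp,
      Fintype.sum_prod_type]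
    have h : ∀ x y : ι → Fin 2, star (maxEntangledVec ι)
        ((Equiv.sumArrowEquivProdArrow ι ι (Fin 2)).symm (x, y)) *
        maxEntangledVec ι ((Equiv.sumArrowEquivProdArrow ι ι (Fin 2)).symm (x, y)) =
        if x = y then 1 / 2 ^ Fintype.card ι else 0 := by
      intro x y
      have h := maxEntangled_apply x x y y
      simp only [and_self] at h
      rw [← h, mul_comm]
      rfl
    simp only [h]
    simp
  · rintro (i | i)
    · exact ⟨pairVec i, Or.inl rfl⟩
    · exact ⟨pairVec i, Or.inr (Or.inr (Or.inl rfl))⟩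
  · intro φ
    have hX : ∀ (i : ι) (x : ι ⊕ ι → Fin 2), (opString pauliX (pairVec i)).mulVec φ x =
        φ (x + Sum.elim (Pi.single i 1) (Pi.single i 1)) := fun i x => by
      rw [opString_pauliX_mulVec, toBits_pairVec]
    constructor
    · intro h
      have hXf : ∀ i x, φ (x + Sum.elim (Pi.single i 1) (Pi.single i 1)) = φ x := fun i x => by
        rw [← hX]; exact congrFun (h (Sum.inl i)) x
      have hZf : ∀ x : ι ⊕ ι → Fin 2, x ∘ Sum.inl ≠ x ∘ Sum.inr → φ x = 0 := by
        intro x hx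
        obtain ⟨i, hi⟩ := Function.ne_iff.1 hx
        simp only [Function.comp_apply] at hi
        have h1 := congrFun (h (Sum.inr i)) x
        rw [Sum.elim_inr, opString_pauliZ_mulVec, zsign_pairVec] at h1
        have h2 : ∀ a b : Fin 2, a ≠ b → (-1 : ℝ) ^ (a.val + b.val) = -1 := by
          intro a b hab
          fin_cases a <;> fin_cases b <;> simp at hab ⊢
        rw [h2 _ _ hi] at h1
        push_cast at h1
        linear_combination (-1 / 2 : ℂ) * h1
      have hF := eq_of_forall_add_single (F := fun x => φ (Sum.elim x x)) fun i x => by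
        rw [← hXf i (Sum.elim x x)]
        congr 1
        funext j
        cases j <;> rfl
      have hne : (((√(2 ^ Fintype.card ι))⁻¹ : ℝ) : ℂ) ≠ 0 := by
        rw [Complex.ofReal_ne_zero]; positivity
      refine ⟨φ (Sum.elim 0 0) / ((√(2 ^ Fintype.card ι))⁻¹ : ℝ), ?_⟩
      funext x
      rw [Pi.smul_apply, smul_eq_mul, maxEntangledVec]
      split_ifs with hx
      · rw [div_mul_cancel₀ _ hne, ← hF (x ∘ Sum.inl)]
        congr 1
        conv_lhs => rw [← Sum.elim_comp_inl_inr x, ← hx]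
      · rw [hZf x hx, mul_zero]
    · rintro ⟨c, rfl⟩ (i | i)
      · funext x
        rw [Sum.elim_inl, hX, Pi.smul_apply, Pi.smul_apply, maxEntangledVec, maxEntangledVec]
        congr 2
        have : ∀ y : ι ⊕ ι → Fin 2, (x + Sum.elim (Pi.single i 1) (Pi.single i 1)) ∘ Sum.inl =
            x ∘ Sum.inl + Pi.single i 1 := fun y => rfl
        have h2 : (x + Sum.elim (Pi.single i 1) (Pi.single i 1)) ∘ Sum.inr =
            x ∘ Sum.inr + Pi.single i 1 := rfl
        rw [this x, h2, add_left_inj]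
      · funext x
        rw [Sum.elim_inr, opString_pauliZ_mulVec, zsign_pairVec, Pi.smul_apply, maxEntangledVec]
        split_ifs with hx
        · have hi : x (Sum.inl i) = x (Sum.inr i) := congrFun hx i
          rw [hi, ← two_mul, pow_mul]
          simp
        · simp

/-! ### Channels in the Wigner representation -/

/-- The block `(x, y)` of the Choi matrix is `2^{-n} E(|x⟩⟨y|)`; the factor `2 ^ card ι` undoes this
normalization. -/
theorem map_apply_eq_sum_choi (E : Op ι →ₗ[ℂ] Op κ) (M : Op ι) (p q : κ → Fin 2) :
    E M p q = ∑ x, ∑ y, M x y *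
      (2 ^ Fintype.card ι * ampl ι E (maxEntangled ι) (Sum.elim x p) (Sum.elim y q)) := by
  have h : ∀ x y : ι → Fin 2,
      2 ^ Fintype.card ι * ampl ι E (maxEntangled ι) (Sum.elim x p) (Sum.elim y q) =
      E (Matrix.single x y 1) p q := by
    intro x y
    have h1 : (Matrix.of fun p q : ι → Fin 2 =>
        maxEntangled ι (Sum.elim x p) (Sum.elim y q)) =
        (1 / 2 ^ Fintype.card ι : ℂ) • Matrix.single x y 1 := by
      ext p q
      simp [maxEntangled_apply, Matrix.single_apply]
    simp only [ampl, Matrix.of_apply, Sum.elim_comp_inl, Sum.elim_comp_inr]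
    rw [h1, map_smul, Matrix.smul_apply, smul_eq_mul]
    field_simp
  simp only [h]
  conv_lhs => rw [Matrix.matrix_eq_sum_single M]
  simp only [map_sum, Matrix.sum_apply]
  refine Finset.sum_congr rfl fun x _ => Finset.sum_congr rfl fun y _ => ?_
  rw [show Matrix.single x y (M x y) = M x y • Matrix.single x y (1 : ℂ) by
    rw [Matrix.smul_single, smul_eq_mul, mul_one], map_smul, Matrix.smul_apply, smul_eq_mul]

theorem IsCompletelyCSSPreserving.choi_mem {E : Op ι →ₗ[ℂ] Op κ}
    (hE : IsCompletelyCSSPreserving E) : ampl ι E (maxEntangled ι) ∈ cssStates (ι ⊕ κ) :=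
  hE.ampl_mem (subset_convexHull ℝ _ isPureCSS_maxEntangled)

theorem IsCompletelyCSSPreserving.im_eq_zero {E : Op ι →ₗ[ℂ] Op κ}
    (hE : IsCompletelyCSSPreserving E) {M : Op ι} (hM : ∀ x y, (M x y).im = 0)
    (p q : κ → Fin 2) : (E M p q).im = 0 := by
  rw [map_apply_eq_sum_choi, Complex.im_sum]
  refine Finset.sum_eq_zero fun x _ => ?_
  rw [Complex.im_sum]
  refine Finset.sum_eq_zero fun y _ => ?_
  have h2 : ((2 : ℂ) ^ Fintype.card ι).im = 0 := by
    rw [show (2 : ℂ) ^ Fintype.card ι = ((2 ^ Fintype.card ι : ℝ) : ℂ) by push_cast; rfl,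
      Complex.ofReal_im]
  simp [Complex.mul_im, hM, im_eq_zero_of_mem_cssStates hE.choi_mem, h2]

theorem phasePoint_sum_apply (u : PhaseSpace ι) (v : PhaseSpace κ) (x y : ι → Fin 2)
    (p q : κ → Fin 2) :
    phasePoint (Sum.elim u.1 v.1, Sum.elim u.2 v.2) (Sum.elim x p) (Sum.elim y q) =
      phasePoint u x y * phasePoint v p q := by
  simp only [phasePoint_apply, Fintype.prod_sum_type, Sum.elim_inl, Sum.elim_inr]

/-- One power of two comes from the Choi normalization, the other from the normalization of `W` on
the larger register. No transpose intervenes, because phase point operators are real. -/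
theorem wignerC_map_phasePoint (E : Op ι →ₗ[ℂ] Op κ) (u : PhaseSpace ι) (v : PhaseSpace κ) :
    wignerC (E (phasePoint u)) v = 2 ^ Fintype.card ι * 2 ^ Fintype.card ι *
      wignerC (ampl ι E (maxEntangled ι)) (Sum.elim u.1 v.1, Sum.elim u.2 v.2) := by
  have hsum : ∀ f : (ι ⊕ κ → Fin 2) → ℂ, ∑ x, f x = ∑ p, ∑ x, f (Sum.elim x p) := fun f => by
    rw [← (Equiv.sumArrowEquivProdArrow ι κ (Fin 2)).symm.sum_comp, Fintype.sum_prod_type,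
      Finset.sum_comm]
    rfl
  rw [wignerC_eq_sum, wignerC_eq_sum]
  simp only [hsum, phasePoint_sum_apply, map_apply_eq_sum_choi E (phasePoint u)]
  have hswap : ∀ f : (κ → Fin 2) → (ι → Fin 2) → (κ → Fin 2) → (ι → Fin 2) → ℂ,
      ∑ p, ∑ x, ∑ q, ∑ y, f p x q y = ∑ p, ∑ q, ∑ x, ∑ y, f p x q y := fun f =>
    Finset.sum_congr rfl fun p _ => Finset.sum_comm
  rw [hswap]
  simp only [Finset.mul_sum, Fintype.card_sum, pow_add]
  refine Finset.sum_congr rfl fun p _ => Finset.sum_congr rfl fun q _ =>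
    Finset.sum_congr rfl fun x _ => Finset.sum_congr rfl fun y _ => ?_
  field_simp

theorem IsCompletelyCSSPreserving.wignerC_map_phasePoint_nonneg {E : Op ι →ₗ[ℂ] Op κ}
    (hE : IsCompletelyCSSPreserving E) (u : PhaseSpace ι) (v : PhaseSpace κ) :
    0 ≤ wignerC (E (phasePoint u)) v := by
  rw [wignerC_map_phasePoint]
  exact mul_nonneg (by positivity) (wignerC_nonneg_of_mem_cssStates hE.choi_mem _)

theorem wignerC_map (E : Op ι →ₗ[ℂ] Op κ) (M : Op ι) (v : PhaseSpace κ) :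
    wignerC (E M) v = ∑ u, wignerC (E (phasePoint u)) v * wignerC M u := by
  conv_lhs => rw [← sum_wignerC_smul_phasePoint M]
  simp only [map_sum, map_smul, wignerC, Matrix.trace_sum, Matrix.mul_smul,
    Matrix.trace_smul, smul_eq_mul, Finset.mul_sum]
  exact Finset.sum_congr rfl fun u _ => by ring

theorem wigner_map (E : Op ι →ₗ[ℂ] Op κ) {M : Op ι} (hM : ∀ x y, (M x y).im = 0)
    (v : PhaseSpace κ) :
    wigner (E M) v = ∑ u, wigner (E (phasePoint u)) v * wigner M u := by
  rw [wigner, wignerC_map, Complex.re_sum]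
  refine Finset.sum_congr rfl fun u _ => ?_
  rw [Complex.mul_re, wignerC_im hM, mul_zero, sub_zero, wigner, wigner]

/-- Completely CSS-preserving protocols do not increase the Rényi divergences. -/
theorem IsCompletelyCSSPreserving.renyiDiv_le {E : Op ι →ₗ[ℂ] Op κ}
    (hE : IsCompletelyCSSPreserving E) {M N : Op ι} (hM : ∀ x y, (M x y).im = 0)
    (hN : ∀ x y, (N x y).im = 0) (hN' : ∀ u, 0 ≤ wigner N u) {α : EReal} (hα : α ∈ orders) :
    renyiDiv α (wigner (E M)) (wigner (E N)) ≤ renyiDiv α (wigner M) (wigner N) := by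
  rw [funext (wigner_map E hM), funext (wigner_map E hN)]
  refine renyiDiv_stochastic_le (S := fun v u => wigner (E (phasePoint u)) v)
    (fun v u => (Complex.le_def.1 (hE.wignerC_map_phasePoint_nonneg u v)).1) (fun u => ?_) _ hN' hα
  -- A column sum is `tr E(A_u) = tr A_u = 1`.
  simp only [wigner]
  rw [← Complex.re_sum, sum_wignerC, hE.1.2, trace_phasePoint, Complex.one_re]

theorem IsCompletelyCSSPreserving.isRebitState {E : Op ι →ₗ[ℂ] Op κ}
    (hE : IsCompletelyCSSPreserving E) {M : Op ι} (hM : IsRebitState M) : IsRebitState (E M) :=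
  ⟨hE.1.isState hM.1, hE.im_eq_zero hM.2⟩

/-! ### Tensor powers -/

theorem sum_curry_prod (n : ℕ) (f : Fin n → (ι → Fin 2) → ℂ) :
    ∑ x : Fin n × ι → Fin 2, ∏ k, f k (fun i => x (k, i)) = ∏ k, ∑ x, f k x := by
  rw [Finset.prod_univ_sum, Fintype.piFinset_univ, ← (Equiv.curry (Fin n) ι (Fin 2)).sum_comp]
  rfl

theorem tensorPow_im {ρ : Op ι} (hρ : ∀ x y, (ρ x y).im = 0) (n : ℕ)
    (x y : Fin n × ι → Fin 2) : (tensorPow n ρ x y).im = 0 := by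
  rw [← Complex.conj_eq_iff_im, tensorPow, Matrix.of_apply, map_prod]
  exact Finset.prod_congr rfl fun k _ => Complex.conj_eq_iff_im.2 (hρ _ _)

theorem tensorPow_mul (n : ℕ) (M N : Op ι) :
    tensorPow n (M * N) = tensorPow n M * tensorPow n N := by
  ext x y
  simp only [tensorPow, Matrix.mul_apply, Matrix.of_apply, ← Finset.prod_mul_distrib]
  exact (sum_curry_prod n fun k z => M (fun i => x (k, i)) z * N z (fun i => y (k, i))).symm

theorem tensorPow_conjTranspose (n : ℕ) (M : Op ι) :
    tensorPow n M.conjTranspose = (tensorPow n M).conjTranspose := by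
  ext x y
  simp only [tensorPow, Matrix.conjTranspose_apply, Matrix.of_apply, star_prod]

-- Positivity: writing `ρ = B† B`, multiplicativity makes the tensor power of the same form.
open scoped MatrixOrder Matrix.Norms.L2Operator in
theorem IsState.tensorPow {ρ : Op ι} (hρ : IsState ρ) (n : ℕ) : IsState (tensorPow n ρ) := by
  constructor
  · obtain ⟨B, hB⟩ := CStarAlgebra.nonneg_iff_eq_star_mul_self.mp hρ.1.nonneg
    rw [hB, Matrix.star_eq_conjTranspose, tensorPow_mul, tensorPow_conjTranspose]
    exact Matrix.posSemidef_conjTranspose_mul_self _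
  · have h := sum_curry_prod n fun _ x => ρ x x
    have h2 : ∑ x, ρ x x = 1 := hρ.2
    rw [h2, Finset.prod_const_one] at h
    exact h

/-- The phase space of `n` copies of a register. -/
def phaseSpaceCurry (n : ℕ) (ι : Type) : PhaseSpace (Fin n × ι) ≃ (Fin n → PhaseSpace ι) where
  toFun u k := (fun i => u.1 (k, i), fun i => u.2 (k, i))
  invFun f := (fun p => (f p.1).1 p.2, fun p => (f p.1).2 p.2)
  left_inv _ := rfl
  right_inv _ := rfl

theorem wignerC_tensorPow (n : ℕ) (ρ : Op ι) (u : PhaseSpace (Fin n × ι)) :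
    wignerC (tensorPow n ρ) u = ∏ k, wignerC ρ (phaseSpaceCurry n ι u k) := by
  simp only [wignerC_eq_sum, Finset.prod_mul_distrib, Finset.prod_const, Finset.card_univ,
    Fintype.card_fin, Fintype.card_prod]
  congr 1
  · rw [div_pow, one_pow, ← pow_mul, mul_comm]
  · rw [← sum_curry_prod]
    refine Finset.sum_congr rfl fun x _ => ?_
    rw [← sum_curry_prod n fun k y => phasePoint (phaseSpaceCurry n ι u k) (fun i => x (k, i)) y *
      ρ (fun i => x (k, i)) y]
    refine Finset.sum_congr rfl fun y _ => ?_
    rw [Finset.prod_mul_distrib]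
    congr 1
    simp only [phasePoint_apply, Fintype.prod_prod_type]
    rfl

theorem wigner_tensorPow (n : ℕ) {ρ : Op ι} (hρ : ∀ x y, (ρ x y).im = 0)
    (u : PhaseSpace (Fin n × ι)) :
    wigner (tensorPow n ρ) u = ∏ k, wigner ρ (phaseSpaceCurry n ι u k) := by
  have h := wignerC_tensorPow n ρ u
  simp only [wignerC_eq_wigner hρ, wignerC_eq_wigner (tensorPow_im hρ n)] at h
  exact_mod_cast h

theorem renyiDiv_tensorPow (n : ℕ) {ρ τ : Op ι} (hρ : ∀ x y, (ρ x y).im = 0)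
    (hτ : ∀ x y, (τ x y).im = 0) (hτ' : ∀ u, 0 ≤ wigner τ u) (α : EReal) :
    renyiDiv α (wigner (tensorPow n ρ)) (wigner (tensorPow n τ)) =
      n * renyiDiv α (wigner ρ) (wigner τ) := by
  rw [funext (wigner_tensorPow n hρ), funext (wigner_tensorPow n hτ), ← renyiDiv_prod α _ hτ']
  exact renyiDiv_comp_equiv (phaseSpaceCurry n ι) α (fun x => ∏ k, wigner ρ (x k))
    (fun x => ∏ k, wigner τ (x k))

end CSS

end

/-! ### Monotonicity under completely CSS-preserving protocols -/

theorem mainTheorem3 :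
    (∀ (r n m : ℕ) (ρ τ : CSS.Op (Fin r)) (ρ' τ' : CSS.Op (Fin m))
        (E : CSS.Op (Fin n × Fin r) →ₗ[ℂ] CSS.Op (Fin m)),
      CSS.IsRebitState ρ →
      τ ∈ CSS.cssInterior (Fin r) →
      CSS.IsCompletelyCSSPreserving E →
      E (CSS.tensorPow n ρ) = ρ' →
      E (CSS.tensorPow n τ) = τ' →
      τ' ∈ CSS.cssInterior (Fin m) →
      CSS.IsRebitState ρ' ∧
      ∀ α ∈ CSS.orders,
        (n : EReal) * CSS.renyiDiv α (CSS.wigner ρ) (CSS.wigner τ) ≥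
          CSS.renyiDiv α (CSS.wigner ρ') (CSS.wigner τ')) ∧
    (∀ (r m : ℕ) (ρ : CSS.Op (Fin r)) (E : CSS.Op (Fin r) →ₗ[ℂ] CSS.Op (Fin m)),
      CSS.IsRebitState ρ →
      CSS.IsCompletelyCSSPreserving E →
      CSS.IsRebitState (E ρ) ∧
      ∀ α ∈ CSS.orders, CSS.cssMonotone α ρ ≥ CSS.cssMonotone α (E ρ)) := by
  refine ⟨?_, ?_⟩
  · rintro r n m ρ τ _ _ E hρ hτ hE rfl rfl -
    have hρn : CSS.IsRebitState (CSS.tensorPow n ρ) :=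
      ⟨hρ.1.tensorPow n, CSS.tensorPow_im hρ.2 n⟩
    have hτ₀ : τ ∈ CSS.cssStates (Fin r) := intrinsicInterior_subset hτ
    have hτr := CSS.im_eq_zero_of_mem_cssStates hτ₀
    have hτw := CSS.wigner_nonneg_of_mem_cssStates hτ₀
    refine ⟨hE.isRebitState hρn, fun α hα => ?_⟩
    rw [← CSS.renyiDiv_tensorPow n hρ.2 hτr hτw]
    refine hE.renyiDiv_le hρn.2 (CSS.tensorPow_im hτr n) (fun u => ?_) hα
    rw [CSS.wigner_tensorPow n hτr]
    exact Finset.prod_nonneg fun k _ => hτw _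
  · intro r m ρ E hρ hE
    refine ⟨hE.isRebitState hρ, fun α hα => le_iInf₂ fun τ hτ => ?_⟩
    -- The image `E τ` is itself a candidate in the infimum for `E ρ`.
    exact (iInf₂_le (E τ) (hE.map_mem hτ)).trans
      (hE.renyiDiv_le hρ.2 (CSS.im_eq_zero_of_mem_cssStates hτ)
        (CSS.wigner_nonneg_of_mem_cssStates hτ) hα)
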